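/- Let $\Bbbk$ be an algebraically closed field of characteristic zero and let $H$ be a finite-dimensional Hopf algebra over $\Bbbk$ with comultiplication $\Delta$ and counit $\varepsilon$. Let $H_0$ be the coradical of $H$, i.e. the sum of all simple subcoalgebras of $H$ (it need not be a subalgebra), and let $G(H)$ be the group of grouplike elements of $H$. Let $A$ be a $\Bbbk$-algebra on which $H$ acts, i.e. $A$ is a left $H$-module, compatibly with its $\Bbbk$-vector space structure, such that $h\cdot(ab)=\sum (h_1\cdot a)(h_2\cdot b)$ and $h\cdot 1_A=\varepsilon(h)1_A$ for all $h\in H$, $a,b\in A$. Assume that the center $Z$ of $A$ is an integral domain and that $A$ is an Azumaya algebra over $Z$. Put $$A^H=\{a\in A : h\cdot a=\varepsilon(h)a\ \ \forall h\in H\},\quad A^{H_0}=\{a\in A : h\cdot a=\varepsilon(h)a\ \ \forall h\in H_0\},\quad A^{G(H)}=\{a\in A: g\cdot a=a\ \ \forall g\in G(H)\}.$$ (i) $Z\cap A^H=Z\cap A^{H_0}$. (ii) If, in addition, $H$ is pointed (i.e. every simple subcoalgebra of $H$ is one-dimensional), then $Z\cap A^H=Z\cap A^{G(H)}$. -/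

import Mathlib

open scoped TensorProduct

namespace HopfAct

section Coalg

variable (k : Type*) {C : Type*} [CommSemiring k] [AddCommMonoid C] [Module k C] [Coalgebra k C]

/-- A subspace `D` of a coalgebra is a subcoalgebra if `Δ(D) ⊆ D ⊗ D`
(the image of `D ⊗ D` in `C ⊗ C`). -/
def IsSubcoalgebra (D : Submodule k C) : Prop :=
  ∀ d ∈ D, Coalgebra.comul (R := k) d ∈ LinearMap.range (TensorProduct.map D.subtype D.subtype)

/-- A simple subcoalgebra: nonzero, with no subcoalgebras besides `0` and itself. -/
structure IsSimpleSubcoalgebra (D : Submodule k C) : Prop where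
  isSubcoalgebra : IsSubcoalgebra k D
  ne_bot : D ≠ ⊥
  eq_bot_or_eq : ∀ E : Submodule k C, IsSubcoalgebra k E → E ≤ D → E = ⊥ ∨ E = D

variable (C) in
/-- The coradical: the sum of all simple subcoalgebras. -/
def coradical : Submodule k C :=
  sSup {D : Submodule k C | IsSimpleSubcoalgebra k D}

variable (C) in
/-- A coalgebra is pointed if all its simple subcoalgebras are one-dimensional. -/
def IsPointed : Prop :=
  ∀ D : Submodule k C, IsSimpleSubcoalgebra k D → Module.finrank k D = 1

end Coalg

section Action

variable (k H A : Type*) [CommSemiring k] [Semiring H] [Bialgebra k H] [Semiring A] [Algebra k A]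
  [Module H A] [IsScalarTower k H A]

variable {A} in
/-- The orbit map `h ↦ h · a`, as a `k`-linear map. -/
def orbitMap (a : A) : H →ₗ[k] A :=
  (LinearMap.toSpanSingleton H A a).restrictScalars k

/-- `H` acts on the algebra `A` (that is, `A` is a left `H`-module algebra): `A` is a left
`H`-module, `h · (a b) = ∑ (h₁ · a) (h₂ · b)` and `h · 1 = ε(h) 1`. -/
class IsModuleAlgebra : Prop where
  smul_mul : ∀ (h : H) (a b : A), h • (a * b) =
    LinearMap.mul' k A
      (TensorProduct.map (orbitMap k H a) (orbitMap k H b) (Coalgebra.comul (R := k) h))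
  smul_one : ∀ h : H, h • (1 : A) = Coalgebra.counit (R := k) h • (1 : A)

variable {H} in
/-- The elements `a` of `A` with `h · a = ε(h) a` for all `h` in the subset `S` of `H`. -/
def invariants (S : Set H) : Set A :=
  {a | ∀ h ∈ S, h • a = Coalgebra.counit (R := k) h • a}

/-- The elements of `A` fixed by the group `G(H)` of grouplike elements of `H`. -/
def grouplikeInvariants : Set A :=
  {a | ∀ g : H, IsGroupLikeElem k g → g • a = a}

end Action

end HopfAct

/-! In the convolution algebra of maps `H → A`, let `ρ(a)` be `h ↦ h · a`, and set `T = ρ(z) - ε z`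
for central `z`. Invariance of `z` on the coradical makes `T` nilpotent, because functionals killing
`H₀` lie in the Jacobson radical of the dual algebra (`isNilpotent_of_vanishes_coradical`).

Nilpotency forces `T = 0` (`coactionDefect_eq_zero_of_isNilpotent`). The identity `T(hh') = ε(h')
T(h) + h · T(h')` writes the pullback of `T` along multiplication as a sum of two commuting terms.
If `T^(r+1) = 0 ≠ T^r`, its `2r`-th power leaves only the middle binomial term, so in characteristic
zero `T^r * ρ(u) = 0` for every value `u` of `T^r`. Since `T` commutes with the image of `ρ`, the
`x` with `T^r * ρ(x) = 0` form a two-sided ideal. For `u ≠ 0` the Azumaya property puts a nonzero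
central element in it. The image of that element under `ρ` is regular, thanks to the antipode, so
`T^r = 0`, a contradiction.

In the pointed case, grouplikes span `H₀`. -/

namespace HopfAct

open WithConv
open scoped Pointwise

/-! ### Convolution algebras and their homomorphisms -/

section Convolution

variable (k : Type*) {C B B' : Type*} [CommRing k] [AddCommGroup C] [Module k C] [Coalgebra k C]
  [Ring B] [Algebra k B] [Ring B'] [Algebra k B']

variable (C) in
/-- The constant `b` of the convolution algebra, that is, `c ↦ ε(c) b`. -/
def convConst (b : B) : WithConv (C →ₗ[k] B) :=
  toConv ((LinearMap.toSpanSingleton k B b).comp Coalgebra.counit)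

theorem convConst_apply (b : B) (c : C) :
    convConst k C b c = Coalgebra.counit (R := k) c • b := rfl

theorem convConst_mul_apply (b : B) (f : WithConv (C →ₗ[k] B)) (c : C) :
    (convConst k C b * f) c = b * f c := by
  rw [(Coalgebra.Repr.arbitrary k c).convMul_apply]
  conv_rhs => rw [← Coalgebra.sum_counit_smul (Coalgebra.Repr.arbitrary k c)]
  rw [map_sum, Finset.mul_sum]
  refine Finset.sum_congr rfl fun i _ ↦ ?_
  rw [convConst_apply, map_smul, smul_mul_assoc, mul_smul_comm]

theorem mul_convConst_apply (b : B) (f : WithConv (C →ₗ[k] B)) (c : C) :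
    (f * convConst k C b) c = f c * b := by
  have h := Coalgebra.sum_tmul_counit_eq (R := k) (Coalgebra.Repr.arbitrary k c)
  have h' := congrArg (TensorProduct.rid k C) h
  simp only [map_sum, TensorProduct.rid_tmul, one_smul] at h'
  rw [(Coalgebra.Repr.arbitrary k c).convMul_apply]
  conv_rhs => rw [← h']
  rw [map_sum, Finset.sum_mul]
  refine Finset.sum_congr rfl fun i _ ↦ ?_
  rw [convConst_apply, map_smul, smul_mul_assoc, mul_smul_comm]

variable (C) in
/-- The constants, as a ring homomorphism to the convolution algebra. -/
def convConstHom : B →+* WithConv (C →ₗ[k] B) where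
  toFun := convConst k C
  map_one' := by
    ext c
    exact (Algebra.algebraMap_eq_smul_one _).symm
  map_zero' := by ext c; exact smul_zero _
  map_add' a b := by ext c; exact smul_add _ _ _
  map_mul' a b := by
    ext c
    refine Eq.trans ?_ (convConst_mul_apply k a (convConst k C b) c).symm
    rw [convConst_apply, convConst_apply, mul_smul_comm]

theorem commute_convConst {b : B} (hb : ∀ x, b * x = x * b) (f : WithConv (C →ₗ[k] B)) :
    convConst k C b * f = f * convConst k C b := by
  ext c
  exact (convConst_mul_apply k b f c).trans
    ((hb _).trans (mul_convConst_apply k b f c).symm)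

variable {k} in
variable (C) in
/-- Composition with an algebra homomorphism, as a homomorphism of convolution algebras. -/
def convPost (φ : B →ₐ[k] B') : WithConv (C →ₗ[k] B) →+* WithConv (C →ₗ[k] B') where
  toFun f := toConv (φ.toLinearMap.comp f.ofConv)
  map_one' := by ext c; exact φ.commutes _
  map_zero' := by ext c; exact map_zero φ
  map_add' f g := by ext c; exact map_add φ _ _
  map_mul' f g := WithConv.ext (LinearMap.algHom_comp_convMul_distrib φ f g)

end Convolution

section Mul

variable (k H : Type*) {B : Type*} [CommRing k] [Ring H] [Bialgebra k H] [Ring B] [Algebra k B]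

/-- The map `f ↦ (h' ↦ (h ↦ f (h h')))` of convolution algebras. -/
def convMulHom : WithConv (H →ₗ[k] B) →+* WithConv (H →ₗ[k] WithConv (H →ₗ[k] B)) where
  toFun f := toConv ((WithConv.linearEquiv k (H →ₗ[k] B)).symm.toLinearMap.comp
    ((LinearMap.llcomp k H H B f.ofConv).comp (LinearMap.mul k H).flip))
  map_one' := by
    ext h' h
    change algebraMap k B (Coalgebra.counit (h * h')) =
      (algebraMap k (WithConv (H →ₗ[k] B)) (Coalgebra.counit h')) h
    rw [LinearMap.convAlgebraMap_apply, Bialgebra.counit_mul, mul_comm, map_mul,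
      Algebra.smul_def]
  map_zero' := by ext h' h; rfl
  map_add' f g := by ext h' h; rfl
  map_mul' f g := by
    ext h' h
    change (f * g) (h * h') = ((toConv ((WithConv.linearEquiv k (H →ₗ[k] B)).symm.toLinearMap.comp
      ((LinearMap.llcomp k H H B f.ofConv).comp (LinearMap.mul k H).flip)) * toConv
      ((WithConv.linearEquiv k (H →ₗ[k] B)).symm.toLinearMap.comp
      ((LinearMap.llcomp k H H B g.ofConv).comp (LinearMap.mul k H).flip)) :
      WithConv (H →ₗ[k] WithConv (H →ₗ[k] B))) h').ofConv h
    let r := Coalgebra.Repr.arbitrary k h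
    let r' := Coalgebra.Repr.arbitrary k h'
    rw [(r.mul r').convMul_apply, r'.convMul_apply, WithConv.ofConv_sum, LinearMap.sum_apply]
    refine Eq.trans (Finset.sum_product_right _ _ _) (Finset.sum_congr rfl fun i _ ↦ ?_)
    rw [r.convMul_apply]
    rfl

end Mul

/-! ### The coaction and the defect of invariance -/

section Coaction

variable (k H A : Type*) [CommRing k] [Ring H] [Ring A] [Algebra k A]

section Bialgebra

variable [Bialgebra k H] [Module H A] [IsScalarTower k H A] [IsModuleAlgebra k H A]

/-- The coaction `a ↦ (h ↦ h · a)` as a homomorphism to the convolution algebra. -/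
noncomputable def coaction : A →ₐ[k] WithConv (H →ₗ[k] A) where
  toFun a := toConv (orbitMap k H a)
  map_one' := by
    ext h
    exact (IsModuleAlgebra.smul_one h).trans (Algebra.algebraMap_eq_smul_one _).symm
  map_mul' a b := by ext h; exact IsModuleAlgebra.smul_mul h a b
  map_zero' := by ext h; exact smul_zero h
  map_add' a b := by ext h; exact smul_add h a b
  commutes' r := by
    ext h
    change h • algebraMap k A r = r • algebraMap k A (Coalgebra.counit h)
    have : SMulCommClass k H A := IsScalarTower.to_smulCommClass
    rw [Algebra.algebraMap_eq_smul_one, smul_comm, IsModuleAlgebra.smul_one (k := k) h,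
      Algebra.algebraMap_eq_smul_one]

variable {A}

theorem coaction_commute {z : A} (hz : ∀ x, z * x = x * z) (a : A) :
    Commute (coaction k H A z) (coaction k H A a) := by
  rw [Commute, SemiconjBy, ← map_mul, hz, map_mul]

/-- The element `h ↦ h · z - ε(h) z` of the convolution algebra. -/
noncomputable def coactionDefect (z : A) : WithConv (H →ₗ[k] A) := coaction k H A z - convConst k H z

theorem coactionDefect_commute {z : A} (hz : ∀ x, z * x = x * z) (a : A) :
    Commute (coactionDefect k H z) (coaction k H A a) :=
  (coaction_commute k H hz a).sub_left (commute_convConst k hz _)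

theorem convMulHom_coactionDefect (z : A) :
    convMulHom k H (coactionDefect k H z) =
      convConstHom k H (coactionDefect k H z) +
        convPost H (coaction k H A) (coactionDefect k H z) := by
  have : SMulCommClass k H A := IsScalarTower.to_smulCommClass
  ext h' h
  change (h * h') • z - Coalgebra.counit (R := k) (h * h') • z =
    Coalgebra.counit (R := k) h' • (h • z - Coalgebra.counit (R := k) h • z) +
      h • (h' • z - Coalgebra.counit (R := k) h' • z)
  rw [mul_smul, Bialgebra.counit_mul, smul_sub, smul_sub, mul_comm, mul_smul,
    smul_comm h (Coalgebra.counit (R := k) h') z]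
  abel

/-- Linearity of the coaction lets the constant `ρ(z)` be rewritten as the image of `ε z` under a
ring homomorphism. As `ε z` is central in the convolution algebra, this image commutes with that of
`T`; what remains is a constant with central value. -/
theorem commute_convConst_convPost_coactionDefect {z : A} (hz : ∀ x, z * x = x * z) :
    Commute (convConstHom k H (coactionDefect k H z))
      (convPost H (coaction k H A) (coactionDefect k H z)) := by
  have hη : ∀ f : WithConv (H →ₗ[k] A), convConst k H z * f = f * convConst k H z :=
    commute_convConst k hz
  have h1 : convPost H (coaction k H A) (convConst k H z) =
      convConstHom k H (coaction k H A z) := by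
    ext h' h
    change (coaction k H A (Coalgebra.counit (R := k) h' • z)) h =
      Coalgebra.counit (R := k) h' • coaction k H A z h
    rw [map_smul]
    rfl
  have h2 : convConstHom k H (coactionDefect k H z) =
      convPost H (coaction k H A) (convConst k H z) -
        convConstHom k H (convConst k H z) := by
    rw [h1, ← map_sub]
    rfl
  rw [h2]
  refine Commute.sub_left ?_ (commute_convConst k hη _)
  rw [Commute, SemiconjBy, ← map_mul, hη, map_mul]

end Bialgebra

section Hopf

variable [HopfAlgebra k H] [Module H A] [IsScalarTower k H A] [IsModuleAlgebra k H A]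
variable {A}

/-- This is the module algebra axiom read in the convolution algebra of `H → End A`. The action map
is invertible there by the antipode, so left multiplication by the coaction of `a` is conjugate to a
constant. -/
theorem coaction_conj (a : A) :
    have : SMulCommClass H k A := IsScalarTower.to_smulCommClass'
    (toConv (Algebra.lsmul k k A : H →ₐ[k] Module.End k A).toLinearMap :
        WithConv (H →ₗ[k] Module.End k A)) *
      convConst k H (Algebra.lmul k A a) =
    convPost H (Algebra.lmul k A) (coaction k H A a) *
      toConv (Algebra.lsmul k k A : H →ₐ[k] Module.End k A).toLinearMap := by
  have : SMulCommClass H k A := IsScalarTower.to_smulCommClass'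
  ext h b
  refine (congrArg (fun F : Module.End k A ↦ F b) (mul_convConst_apply k _ _ h)).trans ?_
  change h • (a * b) = (((convPost H (Algebra.lmul k A) (coaction k H A a) *
      toConv (Algebra.lsmul k k A : H →ₐ[k] Module.End k A).toLinearMap :
      WithConv (H →ₗ[k] Module.End k A)) h : Module.End k A)) b
  rw [(Coalgebra.Repr.arbitrary k h).convMul_apply, LinearMap.sum_apply,
    IsModuleAlgebra.smul_mul (k := k), ← (Coalgebra.Repr.arbitrary k h).eq, map_sum, map_sum]
  rfl

/-- If `z` is left regular in `A`, then its image under the coaction is left regular. -/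
theorem eq_zero_of_coaction_mul_eq_zero {z : A} (hz : ∀ x, z * x = 0 → x = 0)
    {f : WithConv (H →ₗ[k] A)} (hf : coaction k H A z * f = 0) : f = 0 := by
  have : SMulCommClass H k A := IsScalarTower.to_smulCommClass'
  let act : H →ₐ[k] Module.End k A := Algebra.lsmul k k A
  let lam : WithConv (H →ₗ[k] Module.End k A) := convPost H act (toConv LinearMap.id)
  let lam' : WithConv (H →ₗ[k] Module.End k A) :=
    convPost H act (toConv (HopfAlgebra.antipode k))
  have h1 : lam * lam' = 1 := by
    rw [← map_mul, LinearMap.id_mul_antipode, map_one]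
  have h2 : lam' * lam = 1 := by
    rw [← map_mul, LinearMap.antipode_mul_id, map_one]
  have hconj : lam * convConst k H (Algebra.lmul k A z) =
      convPost H (Algebra.lmul k A) (coaction k H A z) * lam := coaction_conj k H z
  let F := convPost H (Algebra.lmul k A) f
  have h3 : convPost H (Algebra.lmul k A) (coaction k H A z) * F = 0 := by
    rw [← map_mul, hf, map_zero]
  have h4 : convConst k H (Algebra.lmul k A z) * (lam' * F) = 0 := by
    calc convConst k H (Algebra.lmul k A z) * (lam' * F)
        = lam' * (lam * convConst k H (Algebra.lmul k A z)) * (lam' * F) := by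
          rw [← mul_assoc lam', h2, one_mul]
      _ = lam' * (convPost H (Algebra.lmul k A) (coaction k H A z) * ((lam * lam') * F)) := by
          rw [hconj]; simp only [mul_assoc]
      _ = 0 := by rw [h1, one_mul, h3, mul_zero]
  have h5 : lam' * F = 0 := by
    ext h b
    apply hz
    have := congrArg (fun G : WithConv (H →ₗ[k] Module.End k A) ↦ G h b) h4
    exact (congrArg (fun G : Module.End k A ↦ G b)
      (convConst_mul_apply k (Algebra.lmul k A z) (lam' * F) h)).symm.trans this
  have h6 : F = 0 := by
    rw [← one_mul F, ← h1, mul_assoc, h5, mul_zero]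
  ext h
  -- Left multiplication operators are determined by their value at `1`.
  have := congrArg (fun G : WithConv (H →ₗ[k] Module.End k A) ↦ G h 1) h6
  exact (mul_one (f h)).symm.trans this

end Hopf

end Coaction

/-! ### Central elements of Azumaya algebras -/

section Azumaya

variable {A : Type*} [Ring A]

/-- Linear functionals separate points of a projective module, which reduces the claim to the domain
`Z`. -/
theorem eq_zero_of_center_mul_eq_zero [IsDomain (Subring.center A)]
    [Module.Projective (Subring.center A) A]
    {z : Subring.center A} (hz : z ≠ 0) (x : A) (hx : (z : A) * x = 0) : x = 0 := by
  rw [← Module.forall_dual_apply_eq_zero_iff (Subring.center A)]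
  intro φ
  have h : φ (z • x) = 0 := by rw [show z • x = (z : A) * x from rfl, hx, map_zero]
  rw [map_smul, smul_eq_mul] at h
  exact (mul_eq_zero.mp h).resolve_left hz

/-- A nonzero two-sided ideal of an Azumaya algebra contains a nonzero central element. -/
theorem exists_center_of_isAzumaya [IsAzumaya (Subring.center A) A] {u : A} (hu : u ≠ 0)
    (I : AddSubgroup A) (hI : ∀ a b : A, a * u * b ∈ I) :
    ∃ z : Subring.center A, z ≠ 0 ∧ (z : A) ∈ I := by
  obtain ⟨φ, hφ⟩ : ∃ φ : Module.Dual (Subring.center A) A, φ u ≠ 0 := by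
    by_contra! h
    exact hu ((Module.forall_dual_apply_eq_zero_iff (Subring.center A) u).mp h)
  refine ⟨φ u, hφ, ?_⟩
  -- Every `Z`-linear endomorphism is a sum of maps `x ↦ a * x * b`; this applies to `x ↦ φ x`, with
  -- central values.
  obtain ⟨t, ht⟩ := (IsAzumaya.bij (R := Subring.center A) (A := A)).2
    ((Algebra.linearMap (Subring.center A) A).comp φ)
  have key : ∀ t, AlgHom.mulLeftRight (Subring.center A) A t u ∈ I := by
    intro t
    induction t with
    | zero => simp
    | tmul a b => rw [AlgHom.mulLeftRight_apply]; exact hI _ _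
    | add s t hs ht => rw [map_add]; exact I.add_mem hs ht
  have := key t
  rw [ht] at this
  exact this

end Azumaya

/-! ### Nilpotent defects vanish -/

section Main

variable {k : Type*} [Field k]
    {H : Type*} [Ring H] [HopfAlgebra k H]
    {A : Type*} [Ring A] [Algebra k A]
    [Module H A] [IsScalarTower k H A] [IsModuleAlgebra k H A]
    [IsDomain (Subring.center A)] [IsAzumaya (Subring.center A) A]

theorem eq_zero_of_mul_coaction_eq_zero {U : WithConv (H →ₗ[k] A)}
    (hU : ∀ a, Commute U (coaction k H A a)) {u : A} (hu : u ≠ 0)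
    (h : U * coaction k H A u = 0) : U = 0 := by
  let I : AddSubgroup A :=
    { carrier := {x | U * coaction k H A x = 0}
      zero_mem' := by simp
      add_mem' := fun {x y} hx hy ↦ by
        simp only [Set.mem_ofPred_eq] at *; rw [map_add, mul_add, hx, hy, add_zero]
      neg_mem' := fun {x} hx ↦ by
        simp only [Set.mem_ofPred_eq] at *; rw [map_neg, mul_neg, hx, neg_zero] }
  obtain ⟨z, hz, hzI⟩ := exists_center_of_isAzumaya hu I fun a b ↦ by
    change U * coaction k H A (a * u * b) = 0
    rw [map_mul, map_mul, ← mul_assoc, ← mul_assoc, (hU a).eq, mul_assoc _ U, h, mul_zero,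
      zero_mul]
  refine eq_zero_of_coaction_mul_eq_zero k H (A := A) (z := (z : A)) (eq_zero_of_center_mul_eq_zero hz) ?_
  rw [← (hU z).eq]
  exact hzI

/-- In characteristic zero, the defect of invariance of a central element is zero as soon as it is
nilpotent. -/
theorem coactionDefect_eq_zero_of_isNilpotent [CharZero k] {z : A} (hz : ∀ x, z * x = x * z)
    (hn : IsNilpotent (coactionDefect k H z)) : coactionDefect k H z = 0 := by
  classical
  by_contra hT
  set T := coactionDefect k H z with hTdef
  -- The shifted exponent makes the least `n` the last one with `T ^ n ≠ 0`.
  have hex : ∃ n, T ^ (n + 1) = 0 := by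
    obtain ⟨n, hn⟩ := hn
    exact ⟨n, by rw [pow_succ, hn, zero_mul]⟩
  obtain ⟨r, hr, hmin⟩ : ∃ r, T ^ (r + 1) = 0 ∧ T ^ r ≠ 0 := by
    refine ⟨Nat.find hex, Nat.find_spec hex, ?_⟩
    rcases h : Nat.find hex with _ | m
    · intro h1
      have h2 := Nat.find_spec hex
      rw [h, zero_add, pow_one] at h2
      exact hT h2
    · exact Nat.find_min hex (m := m) (by omega)
  have hr1 : 1 ≤ r := by
    by_contra h
    obtain rfl : r = 0 := by omega
    exact hT (by simpa using hr)
  have hz0 : ∀ m, r + 1 ≤ m → T ^ m = 0 := fun m hm ↦ pow_eq_zero_of_le hm hr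
  have hcomm := commute_convConst_convPost_coactionDefect k H hz
  rw [← hTdef] at hcomm
  have hsum := convMulHom_coactionDefect k H z
  rw [← hTdef] at hsum
  have hprod : convConstHom k H (T ^ r) * convPost H (coaction k H A) (T ^ r) = 0 := by
    -- Here `2r ≥ r + 1` because `r ≥ 1`. In the expansion, every term except `m = r` has a factor
    -- with exponent above `r`.
    have h1 : (convMulHom k H T) ^ (2 * r) = 0 := by
      rw [← map_pow, hz0 _ (by omega), map_zero]
    rw [hsum, hcomm.add_pow, Finset.sum_eq_single r] at h1
    · rw [show 2 * r - r = r by omega, ← map_pow, ← map_pow, ← nsmul_eq_mul',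
        ← Nat.cast_smul_eq_nsmul k] at h1
      exact (smul_eq_zero.mp h1).resolve_left
        (Nat.cast_ne_zero.mpr (Nat.choose_pos (by omega)).ne')
    · intro m hm hmr
      rcases lt_or_gt_of_ne hmr with hlt | hgt
      · rw [← map_pow _ T (2 * r - m), hz0 (2 * r - m) (by omega), map_zero, mul_zero, zero_mul]
      · rw [← map_pow _ T m, hz0 m (by omega), map_zero, zero_mul, zero_mul]
    · intro h
      exact absurd (Finset.mem_range.mpr (by omega)) h
  obtain ⟨h', hh'⟩ : ∃ h', (T ^ r) h' ≠ 0 := by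
    by_contra! h
    exact hmin (by ext x; exact h x)
  refine hmin (eq_zero_of_mul_coaction_eq_zero
    (fun a ↦ (coactionDefect_commute k H hz a).pow_left r) hh' ?_)
  have := congrArg (fun F : WithConv (H →ₗ[k] WithConv (H →ₗ[k] A)) ↦ F h') hprod
  exact (convConst_mul_apply k (T ^ r) (convPost H (coaction k H A) (T ^ r)) h').symm.trans this

end Main

/-! ### The coradical and the Jacobson radical of the dual algebra -/

/-- In a finite-dimensional algebra, the annihilator of a simple module `K ⧸ m` is maximal among
the proper two-sided ideals. -/
theorem mul_mem_of_isMaximal (k : Type*) {K : Type*} [Field k] [Ring K] [Algebra k K]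
    [FiniteDimensional k K] (m : Ideal K) [hm : m.IsMaximal] (Q : Ideal K) [Q.IsTwoSided]
    (hQ : Q ≠ ⊤) (hmQ : ∀ r, (∀ x, r * x ∈ m) → r ∈ Q) {q : K} (hq : q ∈ Q) (x : K) :
    q * x ∈ m := by
  classical
  have : IsSimpleModule K (K ⧸ m) := isSimpleModule_iff_isCoatom.mpr hm.out
  obtain ⟨M, hM, hQM⟩ := Ideal.exists_le_maximal Q hQ
  have : IsSimpleModule K (K ⧸ M) := isSimpleModule_iff_isCoatom.mpr hM.out
  -- The kernel of `f` is the annihilator of `K ⧸ m`, so `K` modulo that annihilator embeds in a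
  -- finite power of `K ⧸ m`.
  let b := Module.finBasis k K
  let f : K →ₗ[K] (Fin (Module.finrank k K) → K ⧸ m) :=
    LinearMap.pi fun i ↦ LinearMap.toSpanSingleton K (K ⧸ m) (m.mkQ (b i))
  have hf : ∀ r, f r = 0 → ∀ x, r * x ∈ m := by
    intro r hr x
    have h1 : ∀ i, r * b i ∈ m := fun i ↦ by
      have : m.mkQ (r * b i) = 0 := by
        rw [← smul_eq_mul, map_smul]
        exact congrFun hr i
      exact (Submodule.Quotient.mk_eq_zero m).mp this
    rw [← b.sum_repr x, Finset.mul_sum]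
    refine Ideal.sum_mem _ fun i _ ↦ ?_
    rw [mul_smul_comm, ← smul_one_mul]
    exact m.mul_mem_left _ (h1 i)
  let g : (K ⧸ LinearMap.ker f) →ₗ[K] (Fin (Module.finrank k K) → K ⧸ m) :=
    (LinearMap.ker f).liftQ f le_rfl
  have hg : Function.Injective g :=
    LinearMap.ker_eq_bot.mp (Submodule.ker_liftQ_eq_bot _ _ _ le_rfl)
  have hker : LinearMap.ker f ≤ M := fun r hr ↦ hQM (hmQ r (hf r hr))
  -- Semisimplicity of the power extends the projection to `K ⧸ M`. Some component is then nonzero,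
  -- hence embeds `K ⧸ m` in `K ⧸ M`, which `Q` kills.
  obtain ⟨h, hh⟩ := IsSemisimpleModule.extension_property g hg (Submodule.factor hker)
  have hh1 : h (f 1) = M.mkQ 1 := congrArg (fun F ↦ F (Submodule.Quotient.mk 1)) hh
  obtain ⟨i, hi⟩ : ∃ i, h ∘ₗ LinearMap.single K (fun _ ↦ K ⧸ m) i ≠ 0 := by
    by_contra! h0
    have : h = 0 := by
      refine LinearMap.pi_ext fun i v ↦ ?_
      exact congrArg (fun F ↦ F v) (h0 i)
    rw [this, LinearMap.zero_apply] at hh1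
    exact hM.ne_top ((Ideal.eq_top_iff_one M).mpr
      ((Submodule.Quotient.mk_eq_zero M).mp hh1.symm))
  have hinj := LinearMap.injective_of_ne_zero hi
  have key : m.mkQ (q * x) = 0 := by
    apply hinj
    rw [map_zero, ← smul_eq_mul, map_smul, map_smul]
    obtain ⟨y, hy⟩ := M.mkQ_surjective
      ((h ∘ₗ LinearMap.single K (fun _ ↦ K ⧸ m) i) (m.mkQ x))
    rw [← hy, ← map_smul]
    exact (Submodule.Quotient.mk_eq_zero M).mpr (hQM (Ideal.mul_mem_right y Q hq))
  exact (Submodule.Quotient.mk_eq_zero m).mp key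

section Coalgebra

variable {k C : Type*} [Field k] [AddCommGroup C] [Module k C]

theorem tensor_eq_zero_of_dual {t : C ⊗[k] C}
    (h : ∀ p q : Module.Dual k C, LinearMap.mul' k k (TensorProduct.map p q t) = 0) : t = 0 := by
  let b := Module.Basis.ofVectorSpace k C
  apply (b.tensorProduct b).ext_elem
  rintro ⟨i, j⟩
  rw [map_zero, Finsupp.zero_apply, ← h (b.coord i) (b.coord j)]
  clear h
  induction t with
  | zero => simp
  | tmul x y => simp [mul_comm]
  | add s t hs ht => simp only [map_add, Finsupp.add_apply, hs, ht]

variable [Coalgebra k C]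

theorem mul_apply_eq_zero_of_isSubcoalgebra {E : Submodule k C} (hE : IsSubcoalgebra k E)
    {f g : WithConv (C →ₗ[k] k)} (h : (∀ c ∈ E, f c = 0) ∨ ∀ c ∈ E, g c = 0) {c : C}
    (hc : c ∈ E) : (f * g) c = 0 := by
  obtain ⟨s, hs⟩ := hE c hc
  rw [LinearMap.convMul_apply, ← hs, ← LinearMap.comp_apply (TensorProduct.map _ _),
    ← TensorProduct.map_comp]
  rcases h with h | h
  · rw [show f.ofConv ∘ₗ E.subtype = 0 from LinearMap.ext fun x ↦ h x x.2,
      TensorProduct.map_zero_left, LinearMap.zero_apply, map_zero]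
  · rw [show g.ofConv ∘ₗ E.subtype = 0 from LinearMap.ext fun x ↦ h x x.2,
      TensorProduct.map_zero_right, LinearMap.zero_apply, map_zero]

/-- The ideal of the dual algebra orthogonal to a subcoalgebra. -/
def IsSubcoalgebra.orthogonal {E : Submodule k C} (hE : IsSubcoalgebra k E) :
    Ideal (WithConv (C →ₗ[k] k)) where
  carrier := {f | ∀ c ∈ E, f c = 0}
  zero_mem' _ _ := rfl
  add_mem' hf hg c hc :=
    (congrArg₂ (· + ·) (hf c hc) (hg c hc)).trans (add_zero (0 : k))
  smul_mem' _ _ hf _ hc := mul_apply_eq_zero_of_isSubcoalgebra hE (Or.inr hf) hc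

theorem IsSubcoalgebra.isTwoSided_orthogonal {E : Submodule k C} (hE : IsSubcoalgebra k E) :
    hE.orthogonal.IsTwoSided :=
  ⟨fun _ hf _ hc ↦ mul_apply_eq_zero_of_isSubcoalgebra hE (Or.inl hf) hc⟩

/-- The subspace of the linear dual underlying an ideal of the dual algebra. -/
noncomputable def dualSubspace (P : Ideal (WithConv (C →ₗ[k] k))) : Submodule k (Module.Dual k C) :=
  (P.restrictScalars k).comap (WithConv.linearEquiv k (C →ₗ[k] k)).symm.toLinearMap

theorem mem_of_vanishes [FiniteDimensional k C] {P : Ideal (WithConv (C →ₗ[k] k))}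
    {f : WithConv (C →ₗ[k] k)} (hf : ∀ c ∈ (dualSubspace P).dualCoannihilator, f c = 0) :
    f ∈ P := by
  have : f.ofConv ∈ (dualSubspace P).dualCoannihilator.dualAnnihilator :=
    (Submodule.mem_dualAnnihilator _).mpr hf
  rw [Subspace.dualCoannihilator_dualAnnihilator_eq] at this
  exact this

/-- The orthogonal of a two-sided ideal of the dual algebra is a subcoalgebra. -/
theorem isSubcoalgebra_dualCoannihilator [FiniteDimensional k C]
    (P : Ideal (WithConv (C →ₗ[k] k))) [P.IsTwoSided] :
    IsSubcoalgebra k (dualSubspace P).dualCoannihilator := by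
  set D := (dualSubspace P).dualCoannihilator with hD
  intro c hc
  obtain ⟨e, he⟩ := D.subtype.exists_leftInverse_of_injective D.ker_subtype
  let π : C →ₗ[k] C := D.subtype ∘ₗ e
  have hπ : ∀ d ∈ D, π d = d := fun d hd ↦
    congrArg Subtype.val (congrArg (fun F ↦ F ⟨d, hd⟩) he)
  -- Modulo `P` a functional may be precomposed with the projection `π` onto `D`. As `P` is
  -- two-sided, `p * q` and `(p ∘ π) * (q ∘ π)` agree at `c`, which gives `Δ c = (π ⊗ π) Δ c`.
  have hP : ∀ p : Module.Dual k C, toConv (p - p ∘ₗ π) ∈ P := fun p ↦ mem_of_vanishes fun d hd ↦ by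
    change p d - p (π d) = 0
    rw [hπ d hd, sub_self]
  have hvan : ∀ f ∈ P, f c = 0 := fun f hf ↦ (Submodule.mem_dualCoannihilator _).mp hc f.ofConv hf
  have key : Coalgebra.comul (R := k) c -
      TensorProduct.map π π (Coalgebra.comul (R := k) c) = 0 := by
    refine tensor_eq_zero_of_dual fun p q ↦ ?_
    have h1 : (toConv (p - p ∘ₗ π) * toConv q : WithConv (C →ₗ[k] k)) c = 0 :=
      hvan _ (Ideal.mul_mem_right _ _ (hP p))
    have h2 : (toConv (p ∘ₗ π) * toConv (q - q ∘ₗ π) : WithConv (C →ₗ[k] k)) c = 0 :=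
      hvan _ (Ideal.mul_mem_left _ _ (hP q))
    rw [toConv_sub, sub_mul] at h1
    rw [toConv_sub, mul_sub] at h2
    have h3 : LinearMap.mul' k k (TensorProduct.map (p ∘ₗ π) (q ∘ₗ π) (Coalgebra.comul c)) =
        LinearMap.mul' k k (TensorProduct.map p q (Coalgebra.comul c)) :=
      (sub_eq_zero.mp h2).symm.trans (sub_eq_zero.mp h1).symm
    rw [TensorProduct.map_comp, LinearMap.comp_apply] at h3
    rw [map_sub, map_sub, h3, sub_self]
  rw [sub_eq_zero.mp key, TensorProduct.map_comp]
  exact ⟨_, rfl⟩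

theorem exists_isTwoSided_mem_iff_mul_mem {K : Type*} [Ring K] (m : Ideal K) :
    ∃ P : Ideal K, P.IsTwoSided ∧ ∀ r, r ∈ P ↔ ∀ x, r * x ∈ m :=
  ⟨{ carrier := {r | ∀ x, r * x ∈ m}
     zero_mem' := fun x ↦ by rw [zero_mul]; exact m.zero_mem
     add_mem' := fun hr hs x ↦ by rw [add_mul]; exact m.add_mem (hr x) (hs x)
     smul_mem' := fun a r hr x ↦ by
      rw [smul_eq_mul, mul_assoc]; exact m.mul_mem_left a (hr x) },
    ⟨fun b hr x ↦ by rw [mul_assoc]; exact hr (b * x)⟩, fun _ ↦ Iff.rfl⟩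

/-- A functional vanishing on the coradical lies in the Jacobson radical of the dual algebra. -/
theorem mem_jacobson_of_vanishes_coradical [FiniteDimensional k C] {f : WithConv (C →ₗ[k] k)}
    (hf : ∀ c ∈ coradical k C, f c = 0) : f ∈ Ring.jacobson (WithConv (C →ₗ[k] k)) := by
  have : FiniteDimensional k (WithConv (C →ₗ[k] k)) :=
    Module.Finite.equiv (WithConv.linearEquiv k (C →ₗ[k] k)).symm
  rw [Ring.jacobson_eq_sInf_isMaximal, Ideal.mem_sInf]
  intro m hm
  have : m.IsMaximal := hm
  obtain ⟨P, hP2, hP⟩ := exists_isTwoSided_mem_iff_mul_mem m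
  have hD : IsSimpleSubcoalgebra k (dualSubspace P).dualCoannihilator :=
    { isSubcoalgebra := isSubcoalgebra_dualCoannihilator P
      ne_bot := fun h ↦ by
        have h1 : (1 : WithConv (C →ₗ[k] k)) ∈ P := mem_of_vanishes fun c hc ↦ by
          rw [h, Submodule.mem_bot] at hc
          rw [hc]
          exact map_zero _
        have h2 := (hP 1).mp h1 1
        rw [one_mul] at h2
        exact hm.ne_top ((Ideal.eq_top_iff_one m).mpr h2)
      -- For nonzero `E` the orthogonal is a proper two-sided ideal containing `P`, the annihilator
      -- of the simple module. Maximality gives equality, and duality gives `E = D`.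
      eq_bot_or_eq := fun E hE hED ↦ by
        rw [or_iff_not_imp_left]
        intro hE0
        have := hE.isTwoSided_orthogonal
        have hEP {q} := mul_mem_of_isMaximal (q := q) k m hE.orthogonal
          (fun htop ↦ hE0 <| (Submodule.eq_bot_iff E).mpr fun c hc ↦
            (Module.forall_dual_apply_eq_zero_iff k c).mp fun φ ↦ by
              have : toConv φ ∈ hE.orthogonal := htop ▸ Submodule.mem_top
              exact this c hc)
          (fun r hr c hc ↦ (Submodule.mem_dualCoannihilator _).mp (hED hc) r.ofConv
            ((hP r).mpr hr))
        refine le_antisymm hED fun c hc ↦ ?_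
        rw [← Subspace.forall_mem_dualAnnihilator_apply_eq_zero_iff]
        intro φ hφ
        refine (Submodule.mem_dualCoannihilator _).mp hc φ ((hP (toConv φ)).mpr fun x ↦ ?_)
        exact hEP (q := toConv φ) ((Submodule.mem_dualAnnihilator φ).mp hφ) x }
  have hfP : f ∈ P := mem_of_vanishes fun c hc ↦ hf c
    (le_sSup (a := (dualSubspace P).dualCoannihilator) hD hc)
  have := (hP f).mp hfP 1
  rwa [mul_one] at this

variable {B : Type*} [Ring B] [Algebra k B]

/-- The element `c ↦ f c • b` of the convolution algebra. -/
noncomputable def convSMulRight (f : WithConv (C →ₗ[k] k)) (b : B) : WithConv (C →ₗ[k] B) :=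
  toConv (f.ofConv.smulRight b)

theorem convSMulRight_mul (f g : WithConv (C →ₗ[k] k)) (a b : B) :
    convSMulRight f a * convSMulRight g b = convSMulRight (f * g) (a * b) := by
  ext c
  change _ = (f * g) c • (a * b)
  rw [(Coalgebra.Repr.arbitrary k c).convMul_apply, (Coalgebra.Repr.arbitrary k c).convMul_apply,
    Finset.sum_smul]
  exact Finset.sum_congr rfl fun i _ ↦ smul_mul_smul_comm _ _ _ _

/-- An element of the convolution algebra vanishing on the coradical is nilpotent. -/
theorem isNilpotent_of_vanishes_coradical [FiniteDimensional k C] {T : WithConv (C →ₗ[k] B)}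
    (hT : ∀ c ∈ coradical k C, T c = 0) : IsNilpotent T := by
  have : FiniteDimensional k (WithConv (C →ₗ[k] k)) :=
    Module.Finite.equiv (WithConv.linearEquiv k (C →ₗ[k] k)).symm
  have : IsArtinianRing (WithConv (C →ₗ[k] k)) := IsArtinianRing.of_finite k _
  let J := Ring.jacobson (WithConv (C →ₗ[k] k))
  obtain ⟨n, hn⟩ : IsNilpotent J := IsSemiprimaryRing.isNilpotent
  let S : ℕ → Set (WithConv (C →ₗ[k] B)) := fun i ↦ {F | ∃ f ∈ J ^ i, ∃ b, F = convSMulRight f b}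
  have hS : ∀ i, S 1 ^ i ⊆ S i := by
    intro i
    induction i with
    | zero =>
      rw [pow_zero, Set.one_subset]
      refine ⟨1, by rw [Submodule.pow_zero, Ideal.one_eq_top]; exact Submodule.mem_top, 1, ?_⟩
      ext c
      exact Algebra.algebraMap_eq_smul_one _
    | succ i ih =>
      rw [pow_succ]
      rintro _ ⟨F, hF, G, ⟨g, hg, b, rfl⟩, rfl⟩
      obtain ⟨f, hf, a, rfl⟩ := ih hF
      rw [Submodule.pow_one] at hg
      exact ⟨f * g, by rw [Submodule.pow_succ]; exact Ideal.mul_mem_mul hf hg, a * b,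
        convSMulRight_mul f g a b⟩
  -- Coordinates of `T` in a basis of its range vanish on the coradical, hence lie in `J`.
  have hTS : T ∈ Submodule.span k (S 1) := by
    let W := LinearMap.range T.ofConv
    let w := Module.finBasis k W
    let j : Fin (Module.finrank k W) → WithConv (C →ₗ[k] k) := fun i ↦
      toConv (w.coord i ∘ₗ T.ofConv.rangeRestrict)
    have hsum : T = ∑ i, convSMulRight (j i) (w i : B) := by
      ext c
      rw [WithConv.ofConv_sum, LinearMap.sum_apply]
      refine (congrArg Subtype.val (w.sum_repr (T.ofConv.rangeRestrict c))).symm.trans ?_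
      rw [AddSubmonoidClass.coe_finsetSum]
      rfl
    rw [hsum]
    refine Submodule.sum_mem _ fun i _ ↦ Submodule.subset_span ⟨j i, ?_, _, rfl⟩
    rw [Submodule.pow_one]
    refine mem_jacobson_of_vanishes_coradical fun c hc ↦ ?_
    change w.coord i (T.ofConv.rangeRestrict c) = 0
    rw [show T.ofConv.rangeRestrict c = 0 from Subtype.ext (hT c hc), map_zero]
  refine ⟨n, ?_⟩
  have h1 : T ^ n ∈ Submodule.span k (S 1 ^ n) := by
    rw [← Submodule.span_pow]
    exact Submodule.pow_mem_pow _ hTS n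
  have h2 : Submodule.span k (S 1 ^ n) ≤ ⊥ := by
    refine Submodule.span_le.mpr fun F hF ↦ ?_
    obtain ⟨f, hf, b, rfl⟩ := hS n hF
    rw [hn] at hf
    obtain rfl : f = 0 := hf
    ext c
    exact zero_smul k b
  exact h2 h1

/-- In a pointed coalgebra, every simple subcoalgebra is spanned by a grouplike element. -/
theorem IsSimpleSubcoalgebra.exists_grouplike (hC : IsPointed k C) {D : Submodule k C}
    (hD : IsSimpleSubcoalgebra k D) :
    ∃ g : C, IsGroupLikeElem k g ∧ ∀ d ∈ D, ∃ r : k, d = r • g := by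
  obtain ⟨v, hv0, hv⟩ := finrank_eq_one_iff'.mp (hC D hD)
  obtain ⟨s, hs⟩ := hD.isSubcoalgebra v v.2
  obtain ⟨c, hc⟩ : ∃ c : k, Coalgebra.comul (R := k) (v : C) = c • ((v : C) ⊗ₜ[k] (v : C)) := by
    rw [← hs]
    clear hs
    induction s with
    | zero => exact ⟨0, by simp⟩
    | tmul x y =>
      obtain ⟨a, rfl⟩ := hv x
      obtain ⟨b, rfl⟩ := hv y
      exact ⟨a * b, by
        simp [TensorProduct.tmul_smul, ← TensorProduct.smul_tmul', smul_smul, mul_comm]⟩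
    | add s t hs ht =>
      obtain ⟨a, ha⟩ := hs
      obtain ⟨b, hb⟩ := ht
      exact ⟨a + b, by rw [map_add, ha, hb, add_smul]⟩
  have hv0' : (v : C) ≠ 0 := fun h ↦ hv0 (Subtype.ext h)
  -- The counit axiom applied to `Δ v = c • (v ⊗ v)` fixes the scaling: `c • v` is grouplike.
  have hcv : c * Coalgebra.counit (R := k) (v : C) = 1 := by
    have h1 := Coalgebra.rTensor_counit_comul (R := k) (v : C)
    rw [hc, map_smul, LinearMap.rTensor_tmul] at h1
    have h2 := congrArg (TensorProduct.lid k C) h1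
    rw [map_smul, TensorProduct.lid_tmul, TensorProduct.lid_tmul, one_smul, smul_smul] at h2
    have h3 : (c * Coalgebra.counit (R := k) (v : C) - 1) • (v : C) = 0 := by
      rw [sub_smul, h2, one_smul, sub_self]
    exact sub_eq_zero.mp ((smul_eq_zero.mp h3).resolve_right hv0')
  have hc0 : c ≠ 0 := left_ne_zero_of_mul_eq_one hcv
  refine ⟨c • (v : C), ⟨by rw [map_smul, smul_eq_mul, hcv], ?_⟩, fun d hd ↦ ?_⟩
  · rw [map_smul, hc, TensorProduct.smul_tmul_smul, smul_smul]
  · obtain ⟨r, hr⟩ := hv ⟨d, hd⟩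
    refine ⟨r * c⁻¹, ?_⟩
    rw [smul_smul, inv_mul_cancel_right₀ hc0]
    exact (congrArg Subtype.val hr).symm

end Coalgebra

/-! ### Comparison of the invariants -/

theorem invariants_eq_of_coradical {k : Type*} [Field k] [CharZero k]
    {H : Type*} [Ring H] [HopfAlgebra k H] [FiniteDimensional k H]
    {A : Type*} [Ring A] [Algebra k A]
    [Module H A] [IsScalarTower k H A] [IsModuleAlgebra k H A]
    [IsDomain (Subring.center A)] [IsAzumaya (Subring.center A) A] {z : A}
    (hz : z ∈ Subring.center A) (h : z ∈ invariants k A (coradical k H : Set H)) :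
    z ∈ invariants k A (Set.univ : Set H) := by
  have hz' : ∀ x, z * x = x * z := fun x ↦ (Subring.mem_center_iff.mp hz x).symm
  have h0 := coactionDefect_eq_zero_of_isNilpotent hz' <|
    isNilpotent_of_vanishes_coradical (T := coactionDefect k H z) fun c hc ↦
      sub_eq_zero.mpr (h c hc)
  intro c _
  exact sub_eq_zero.mp (congrArg (fun F : WithConv (H →ₗ[k] A) ↦ F c) h0)

theorem grouplikeInvariants_subset {k : Type*} [Field k]
    {H : Type*} [Ring H] [Bialgebra k H] {A : Type*} [Ring A] [Algebra k A]
    [Module H A] [IsScalarTower k H A] (hH : IsPointed k H) :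
    grouplikeInvariants k H A ⊆ invariants k A (coradical k H : Set H) := by
  intro a ha
  have key : coradical k H ≤ LinearMap.ker (orbitMap k H a -
      (LinearMap.toSpanSingleton k A a).comp Coalgebra.counit) := by
    refine sSup_le fun D hD d hd ↦ ?_
    obtain ⟨g, hg, hDg⟩ := IsSimpleSubcoalgebra.exists_grouplike hH hD
    obtain ⟨r, rfl⟩ := hDg d hd
    rw [LinearMap.mem_ker, map_smul]
    refine (congrArg (r • ·) ?_).trans (smul_zero r)
    change g • a - Coalgebra.counit (R := k) g • a = 0
    rw [ha g hg, hg.counit_eq_one, one_smul, sub_self]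
  exact fun h hh ↦ sub_eq_zero.mp (key hh)

end HopfAct

theorem theorem3p10 {k : Type*} [Field k] [IsAlgClosed k] [CharZero k]
    {H : Type*} [Ring H] [HopfAlgebra k H] [FiniteDimensional k H]
    {A : Type*} [Ring A] [Algebra k A]
    [Module H A] [IsScalarTower k H A] [HopfAct.IsModuleAlgebra k H A]
    [IsDomain (Subring.center A)] [IsAzumaya (Subring.center A) A] :
    ((Subring.center A : Set A) ∩ HopfAct.invariants k A (Set.univ : Set H) =
      (Subring.center A : Set A) ∩ HopfAct.invariants k A (HopfAct.coradical k H : Set H)) ∧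
    (HopfAct.IsPointed k H →
      (Subring.center A : Set A) ∩ HopfAct.invariants k A (Set.univ : Set H) =
        (Subring.center A : Set A) ∩ HopfAct.grouplikeInvariants k H A) := by
  refine ⟨?_, fun hH ↦ ?_⟩
  · ext z
    exact ⟨fun h ↦ ⟨h.1, fun x _ ↦ h.2 x (Set.mem_univ x)⟩,
      fun h ↦ ⟨h.1, HopfAct.invariants_eq_of_coradical h.1 h.2⟩⟩
  · ext z
    refine ⟨fun h ↦ ⟨h.1, fun g hg ↦ ?_⟩, fun h ↦ ⟨h.1, HopfAct.invariants_eq_of_coradical h.1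
      (HopfAct.grouplikeInvariants_subset hH h.2)⟩⟩
    rw [h.2 g (Set.mem_univ g), hg.counit_eq_one, one_smul]
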